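/- Let $q\ge 1$, let $a<b$ be real numbers, and let $s_0,s_1,\dots$ be complex $q\times q$ matrices. Put $$\widehat s_k=-ab\,s_k+(a+b)s_{k+1}-s_{k+2},\qquad H_{1,j}=(s_{l+k})_{l,k=0}^{j},\quad H_{2,j}=(\widehat s_{l+k})_{l,k=0}^{j},$$ $$K_{1,j}=(bs_{l+k}-s_{l+k+1})_{l,k=0}^{j},\qquad K_{2,j}=(-as_{l+k}+s_{l+k+1})_{l,k=0}^{j}$$ (block matrices with $j+1$ block rows and columns). The sequence $(s_k)_{k=0}^{2n}$ is called Hausdorff positive definite if $H_{1,n}$ and (for $n\ge1$) $H_{2,n-1}$ are positive definite; $(s_k)_{k=0}^{2n+1}$ is called Hausdorff positive definite if $K_{1,n}$ and $K_{2,n}$ are positive definite. Let $T_j$ be the $(j+1)\times(j+1)$ block matrix with blocks $I_q$ on the first subdiagonal and zero blocks elsewhere, $R_j(z)=(I-zT_j)^{-1}$, and let $v_j$, $u_{2,j}$, $\widetilde u_{2,j}$ be the columns of $j+1$ blocks $$v_j=(I_q,0,\dots,0),\quad u_{2,j}=(-(a+b)s_0+s_1,\,-\widehat s_0,\dots,-\widehat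 s_{j-1}),\quad \widetilde u_{2,j}=(-s_0,\,-s_1+as_0,\dots,-s_j+as_{j-1}).$$ For $j\ge1$ let $Y_{1,j},Y_{2,j},\widetilde Y_{1,j},\widetilde Y_{2,j}$ be the columns of $j$ blocks with entries, for $j\le k\le 2j-1$, $s_k$, $\widehat s_k$, $bs_k-s_{k+1}$ and $-as_k+s_{k+1}$, respectively. Define the matrix polynomials $P_{1,0}=\Gamma_{1,0}=I_q$, $\Theta_{2,0}=-s_0$, $Q_{2,0}(z)=(a+b)s_0-s_1-zs_0$, and for $j\ge1$ $$P_{1,j}(z)=(-Y_{1,j}^*H_{1,j-1}^{-1},I_q)R_j(z)v_j,\qquad Q_{2,j}(z)=-(-Y_{2,j}^*H_{2,j-1}^{-1},I_q)R_j(z)(u_{2,j}+zv_js_0),$$ $$\Gamma_{1,j}(z)=(-\widetilde Y_{1,j}^*K_{1,j-1}^{-1},I_q)R_j(z)v_j,\qquad \Theta_{2,j}(z)=(-\widetilde Y_{2,j}^*K_{2,j-1}^{-1},I_q)R_j(z)\widetilde u_{2,j}.$$ Put $$\mathbf t_j=v_j^*R_j(a)^*K_{1,j}^{-1}R_j(a)v_j,\qquad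 \boldsymbol\lambda_j=(u_{2,j}^*+as_0v_j^*)R_j(a)^*H_{2,j}^{-1}R_j(a)(u_{2,j}+av_js_0),$$ $$\mu_j=v_j^*R_j(a)^*H_{1,j}^{-1}R_j(a)v_j,\qquad \lambda_j=\widetilde u_{2,j}^*R_j(a)^*K_{2,j}^{-1}R_j(a)\widetilde u_{2,j}.$$ The new DSM (Dyukarev--Stieltjes matrix) parameters are $\mathbf m_0=\mathbf t_0$, $\mathbf l_0=\boldsymbol\lambda_0$ and $\mathbf m_j=\mathbf t_j-\mathbf t_{j-1}$, $\mathbf l_j=\boldsymbol\lambda_j-\boldsymbol\lambda_{j-1}$ for $j\ge1$; the old ones are $M_0(a)=s_0^{-1}$, $L_0(a)=\lambda_0$ and $M_j(a)=\mu_j-\mu_{j-1}$, $L_j(a)=\lambda_j-\lambda_{j-1}$ for $j\ge1$. **Proposition 7.6.** a) Let $n\ge 1$ and let $(s_k)_{k=0}^{2n}$ be Hausdorff positive definite. Then the matrices $Q_{2,j}(a)$ and $\Gamma_{1,j+1}(a)$, $0\le j\le n-1$, are invertible, and $$\mathbf m_0=Q_{2,0}^{-1}(a),\qquad \mathbf m_j=Q_{2,j}^{-1}(a)\,\Gamma_{1,j}(a),\qquad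 \mathbf l_j=-\Gamma_{1,j+1}^{-1}(a)\,Q_{2,j}(a)\qquad(0\le j\le n-1).$$ b) Let $n\ge 0$ and let $(s_k)_{k=0}^{2n+1}$ be Hausdorff positive definite. Then the matrices $\Theta_{2,j}(a)$ and $P_{1,j+1}(a)$, $0\le j\le n$, are invertible, and $$M_0(a)=-\Theta_{2,0}^{-1}(a),\qquad M_j(a)=-\Theta_{2,j}^{-1}(a)\,P_{1,j}(a)\quad(1\le j\le n),\qquad L_j(a)=P_{1,j+1}^{-1}(a)\,\Theta_{2,j}(a)\quad(0\le j\le n).$$ -/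

import Mathlib

open scoped Matrix ComplexOrder

namespace HausdorffMoment

noncomputable section

/-- A sequence of complex `q × q` matrices; only an initial segment of it is ever used. -/
abbrev MatSeq (q : ℕ) := ℕ → Matrix (Fin q) (Fin q) ℂ

/-- `(j+1)q × (j+1)q` matrices, seen as `(j+1) × (j+1)` matrices of `q × q` blocks. -/
abbrev BlockSq (q j : ℕ) := Matrix (Fin (j + 1) × Fin q) (Fin (j + 1) × Fin q) ℂ

/-- Columns of `j+1` blocks of size `q × q`. -/
abbrev BlockCol (q j : ℕ) := Matrix (Fin (j + 1) × Fin q) (Fin q) ℂ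

/-- Rows of `j+1` blocks of size `q × q`. -/
abbrev BlockRow (q j : ℕ) := Matrix (Fin q) (Fin (j + 1) × Fin q) ℂ

variable {q : ℕ}

/-- The block column with blocks `f 0, f 1, …, f j`. -/
def blockCol (f : MatSeq q) (j : ℕ) : BlockCol q j :=
  Matrix.of fun p c => f p.1 p.2 c

/-- The block Hankel matrix with `(l, k)` block `f (l + k)`, for `0 ≤ l, k ≤ j`. -/
def blockHankel (f : MatSeq q) (j : ℕ) : BlockSq q j :=
  Matrix.of fun p r => f ((p.1 : ℕ) + (r.1 : ℕ)) p.2 r.2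

/-- `ŝ_k = -ab s_k + (a+b) s_{k+1} - s_{k+2}`. -/
def sHat (s : MatSeq q) (a b : ℝ) : MatSeq q := fun k =>
  -(((a * b : ℝ) : ℂ) • s k) + ((a + b : ℝ) : ℂ) • s (k + 1) - s (k + 2)

/-- `b s_k - s_{k+1}`. -/
def sUpper (s : MatSeq q) (b : ℝ) : MatSeq q := fun k => (b : ℂ) • s k - s (k + 1)

/-- `-a s_k + s_{k+1}`. -/
def sLower (s : MatSeq q) (a : ℝ) : MatSeq q := fun k => -((a : ℂ) • s k) + s (k + 1)

/-- `H_{1,j}`, with blocks `s_{l+k}`. -/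
def H1 (s : MatSeq q) (j : ℕ) : BlockSq q j := blockHankel s j

/-- `H_{2,j}`, with blocks `-ab s_{l+k} + (a+b) s_{l+k+1} - s_{l+k+2}`. -/
def H2 (s : MatSeq q) (a b : ℝ) (j : ℕ) : BlockSq q j := blockHankel (sHat s a b) j

/-- `K_{1,j}`, with blocks `b s_{l+k} - s_{l+k+1}`. -/
def K1 (s : MatSeq q) (b : ℝ) (j : ℕ) : BlockSq q j := blockHankel (sUpper s b) j

/-- `K_{2,j}`, with blocks `-a s_{l+k} + s_{l+k+1}`. -/
def K2 (s : MatSeq q) (a : ℝ) (j : ℕ) : BlockSq q j := blockHankel (sLower s a) j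

/-- `(s_k)_{k=0}^{2n}` is a Hausdorff positive definite sequence on `[a,b]`: both `H_{1,n}` and
`H_{2,n-1}` are positive definite (for `n = 0` there is no matrix `H_{2,n-1}`). -/
def HausdorffPosDefEven (s : MatSeq q) (a b : ℝ) (n : ℕ) : Prop :=
  (H1 s n).PosDef ∧ ∀ i, i + 1 = n → (H2 s a b i).PosDef

/-- `(s_k)_{k=0}^{2n+1}` is a Hausdorff positive definite sequence on `[a,b]`: both `K_{1,n}` and
`K_{2,n}` are positive definite. -/
def HausdorffPosDefOdd (s : MatSeq q) (a b : ℝ) (n : ℕ) : Prop :=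
  (K1 s b n).PosDef ∧ (K2 s a n).PosDef

/-- The block shift `T_j`: identity blocks just below the diagonal, zero blocks elsewhere. -/
def T (q j : ℕ) : BlockSq q j :=
  Matrix.of fun p r => if (p.1 : ℕ) = (r.1 : ℕ) + 1 ∧ p.2 = r.2 then 1 else 0

/-- `R_j(z) = (I - z T_j)⁻¹`. -/
def R (q j : ℕ) (z : ℂ) : BlockSq q j := (1 - z • T q j)⁻¹

/-- `v_j = (I, 0, …, 0)ᵀ`. -/
def v (q j : ℕ) : BlockCol q j :=
  blockCol (fun k => if k = 0 then 1 else 0) j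

/-- `u_{2,0} = -(a+b) s_0 + s_1`, a `q × q` matrix. -/
def u20 (s : MatSeq q) (a b : ℝ) : Matrix (Fin q) (Fin q) ℂ :=
  -(((a + b : ℝ) : ℂ) • s 0) + s 1

/-- `u_{2,j}`: the block column `u_{2,0}, -ŝ_0, …, -ŝ_{j-1}`. -/
def u2 (s : MatSeq q) (a b : ℝ) (j : ℕ) : BlockCol q j :=
  blockCol (fun k => match k with
    | 0 => u20 s a b
    | l + 1 => -sHat s a b l) j

/-- `ũ_{2,j}`: the block column `-s_0, -s_1 + a s_0, …, -s_j + a s_{j-1}`. -/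
def uTilde2 (s : MatSeq q) (a : ℝ) (j : ℕ) : BlockCol q j :=
  blockCol (fun k => match k with
    | 0 => -s 0
    | l + 1 => -s (l + 1) + (a : ℂ) • s l) j

/-- For a sequence `f` with block Hankel matrix `F_j = blockHankel f j` and the block column
`Y_{j+1} = (f_{j+1}, …, f_{2j+1})ᵀ`, this is the block row `(-Y_{j+1}ᴴ F_j⁻¹, I)` of `j+2` blocks.
It is the row that enters the definition of the polynomials of index `j + 1`. -/
def orthoRow (f : MatSeq q) (j : ℕ) : BlockRow q (j + 1) :=
  Matrix.of fun i p =>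
    if h : (p.1 : ℕ) < j + 1 then
      (-((blockCol (fun k => f (j + 1 + k)) j)ᴴ * (blockHankel f j)⁻¹)) i (⟨p.1, h⟩, p.2)
    else (1 : Matrix (Fin q) (Fin q) ℂ) i p.2

/-- `P_{1,0} = I`, `P_{1,j}(z) = (-Y_{1,j}ᴴ H_{1,j-1}⁻¹, I) R_j(z) v_j`. -/
def P1 (s : MatSeq q) : ℕ → ℂ → Matrix (Fin q) (Fin q) ℂ
  | 0, _ => 1
  | j + 1, z => orthoRow s j * R q (j + 1) z * v q (j + 1)

/-- `Q_{2,0}(z) = -(u_{2,0} + z s_0)`,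
`Q_{2,j}(z) = -(-Y_{2,j}ᴴ H_{2,j-1}⁻¹, I) R_j(z) (u_{2,j} + z v_j s_0)`. -/
def Q2 (s : MatSeq q) (a b : ℝ) : ℕ → ℂ → Matrix (Fin q) (Fin q) ℂ
  | 0, z => -(u20 s a b + z • s 0)
  | j + 1, z => -(orthoRow (sHat s a b) j * R q (j + 1) z *
      (u2 s a b (j + 1) + z • (v q (j + 1) * s 0)))

/-- `Γ_{1,0} = I`, `Γ_{1,j}(z) = (-Ỹ_{1,j}ᴴ K_{1,j-1}⁻¹, I) R_j(z) v_j`. -/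
def Gamma1 (s : MatSeq q) (b : ℝ) : ℕ → ℂ → Matrix (Fin q) (Fin q) ℂ
  | 0, _ => 1
  | j + 1, z => orthoRow (sUpper s b) j * R q (j + 1) z * v q (j + 1)

/-- `Θ_{2,0} = -s_0`, `Θ_{2,j}(z) = (-Ỹ_{2,j}ᴴ K_{2,j-1}⁻¹, I) R_j(z) ũ_{2,j}`. -/
def Theta2 (s : MatSeq q) (a : ℝ) : ℕ → ℂ → Matrix (Fin q) (Fin q) ℂ
  | 0, _ => -s 0
  | j + 1, z => orthoRow (sLower s a) j * R q (j + 1) z * uTilde2 s a (j + 1)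

/-- `v_jᴴ R_j(a)ᴴ K_{1,j}⁻¹ R_j(a) v_j`. -/
def tNew (s : MatSeq q) (a b : ℝ) (j : ℕ) : Matrix (Fin q) (Fin q) ℂ :=
  (v q j)ᴴ * (R q j a)ᴴ * (K1 s b j)⁻¹ * R q j a * v q j

/-- `(u_{2,j}ᴴ + a s_0 v_jᴴ) R_j(a)ᴴ H_{2,j}⁻¹ R_j(a) (u_{2,j} + a v_j s_0)`. -/
def lSum (s : MatSeq q) (a b : ℝ) (j : ℕ) : Matrix (Fin q) (Fin q) ℂ :=
  ((u2 s a b j)ᴴ + (a : ℂ) • (s 0 * (v q j)ᴴ)) * (R q j a)ᴴ * (H2 s a b j)⁻¹ * R q j a *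
    (u2 s a b j + (a : ℂ) • (v q j * s 0))

/-- The new (second type) Dyukarev–Stieltjes parameters `𝐦_j(a,b)`. -/
def mNew (s : MatSeq q) (a b : ℝ) : ℕ → Matrix (Fin q) (Fin q) ℂ
  | 0 => tNew s a b 0
  | j + 1 => tNew s a b (j + 1) - tNew s a b j

/-- The new (second type) Dyukarev–Stieltjes parameters `𝐥_j(a,b)`, `j ≥ 0`. -/
def lNew (s : MatSeq q) (a b : ℝ) : ℕ → Matrix (Fin q) (Fin q) ℂ
  | 0 => ((u2 s a b 0)ᴴ + (a : ℂ) • (s 0 * (v q 0)ᴴ)) * (H2 s a b 0)⁻¹ *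
      (u2 s a b 0 + (a : ℂ) • (v q 0 * s 0))
  | j + 1 => lSum s a b (j + 1) - lSum s a b j

/-- `v_jᴴ R_j(a)ᴴ H_{1,j}⁻¹ R_j(a) v_j`. -/
def mSumOld (s : MatSeq q) (a : ℝ) (j : ℕ) : Matrix (Fin q) (Fin q) ℂ :=
  (v q j)ᴴ * (R q j a)ᴴ * (H1 s j)⁻¹ * R q j a * v q j

/-- `ũ_{2,j}ᴴ R_j(a)ᴴ K_{2,j}⁻¹ R_j(a) ũ_{2,j}`. -/
def lSumOld (s : MatSeq q) (a : ℝ) (j : ℕ) : Matrix (Fin q) (Fin q) ℂ :=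
  (uTilde2 s a j)ᴴ * (R q j a)ᴴ * (K2 s a j)⁻¹ * R q j a * uTilde2 s a j

/-- The old (first type) Dyukarev–Stieltjes parameters `M_j(a)`. -/
def mOld (s : MatSeq q) (a : ℝ) : ℕ → Matrix (Fin q) (Fin q) ℂ
  | 0 => (s 0)⁻¹
  | j + 1 => mSumOld s a (j + 1) - mSumOld s a j

/-- The old (first type) Dyukarev–Stieltjes parameters `L_j(a)`. -/
def lOld (s : MatSeq q) (a : ℝ) : ℕ → Matrix (Fin q) (Fin q) ℂ
  | 0 => (uTilde2 s a 0)ᴴ * (K2 s a 0)⁻¹ * uTilde2 s a 0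
  | j + 1 => lSumOld s a (j + 1) - lSumOld s a j

end

end HausdorffMoment

open HausdorffMoment

namespace HausdorffMoment

/-! ### Schur complement of a bordered Hermitian matrix -/

section Schur

variable {m n : Type*} [Fintype m] [DecidableEq m] [Fintype n] [DecidableEq n]

/-! Both halves are one statement about a Hermitian sequence `g` and `f = sLower g a` (the weight `x
- a`): take `g = s` for the old parameters and `g = sUpper s b`, where `f = sHat s a b`, for the new
ones. Applying `R_j(a)` turns `v_j` into the powers of `a` and `uTilde2` into minus the column of
`g`. So, up to sign, all polynomial values are values of monic orthogonal polynomials: `p_j(a)` for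
`g`, and `θ_j[g]` for `f`, with powers of `x` replaced by entries of `g`.

By Schur complements each parameter is `Xᴴ N⁻¹ X`, with `X` such a value and `N` the squared norm of
the polynomial (`invFormStep_eq`). The norms factor: `N_j(g) = p_j(a) θ_j[g]ᴴ` and `N_j(f) =
-p_{j+1}(a) θ_j[g]ᴴ`. Both come from dividing the polynomial of `g` by `x - a`, pairing with `θ_j`
and using orthogonality (`orthoEval_pairing`). As `N` is Hermitian and invertible, the factors are
invertible and `Xᴴ N⁻¹ X` collapses to a quotient (`form_eq_of_factorization`). -/

theorem inv_neg_matrix (A : Matrix m m ℂ) (hA : IsUnit A) :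
    (-A)⁻¹ = -A⁻¹ := by
  refine Matrix.inv_eq_left_inv ?_
  rw [neg_mul_neg, Matrix.nonsing_inv_mul _ ((Matrix.isUnit_iff_isUnit_det _).1 hA)]

/-- The increment of the form `xᴴ A⁻¹ x` when the Hermitian matrix `A` is bordered. -/
theorem schur_increment {A : Matrix m m ℂ} {B : Matrix m n ℂ} {D : Matrix n n ℂ}
    (hA : IsUnit A) (hAh : A.IsHermitian) (hM : IsUnit (Matrix.fromBlocks A B Bᴴ D))
    (x : Matrix m n ℂ) (y : Matrix n n ℂ) :
    IsUnit (D - Bᴴ * A⁻¹ * B) ∧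
    (Matrix.fromRows x y)ᴴ * (Matrix.fromBlocks A B Bᴴ D)⁻¹ * Matrix.fromRows x y - xᴴ * A⁻¹ * x =
      (y - Bᴴ * A⁻¹ * x)ᴴ * (D - Bᴴ * A⁻¹ * B)⁻¹ * (y - Bᴴ * A⁻¹ * x) := by
  let _ := hA.invertible
  let _ := hM.invertible
  have hS : IsUnit (D - Bᴴ * A⁻¹ * B) := by
    have := (Matrix.isUnit_fromBlocks_iff_of_invertible₁₁ (A := A) (B := B) (C := Bᴴ) (D := D)).1 hM
    rwa [Matrix.invOf_eq_nonsing_inv] at this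
  refine ⟨hS, ?_⟩
  let _ : Invertible (D - Bᴴ * ⅟A * B) := by
    rw [Matrix.invOf_eq_nonsing_inv]; exact hS.invertible
  have hi : (A⁻¹)ᴴ = A⁻¹ := hAh.inv
  rw [← Matrix.invOf_eq_nonsing_inv (Matrix.fromBlocks A B Bᴴ D), Matrix.invOf_fromBlocks₁₁_eq]
  simp only [Matrix.invOf_eq_nonsing_inv]
  rw [Matrix.conjTranspose_fromRows_eq_fromCols_conjTranspose, Matrix.fromCols_mul_fromBlocks,
    Matrix.fromCols_mul_fromRows]
  simp only [Matrix.conjTranspose_sub, Matrix.conjTranspose_mul, Matrix.conjTranspose_conjTranspose,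
    hi, Matrix.mul_add, Matrix.add_mul, Matrix.mul_sub, Matrix.sub_mul, Matrix.mul_neg,
    Matrix.neg_mul, Matrix.mul_assoc]
  abel

end Schur

/-! ### Bordering block Hankel matrices -/

section Blocks

variable {q : ℕ}

/-- Split off the last block index. -/
def lastBlockEquiv (q j : ℕ) : (Fin (j + 1) × Fin q) ⊕ Fin q ≃ Fin (j + 2) × Fin q where
  toFun := Sum.elim (fun p => (p.1.castSucc, p.2)) (fun c => (Fin.last (j + 1), c))
  invFun p := if h : (p.1 : ℕ) < j + 1 then Sum.inl (⟨p.1, h⟩, p.2) else Sum.inr p.2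
  left_inv := by
    rintro (⟨i, c⟩ | c)
    · simp [i.2]
    · simp
  right_inv := by
    rintro ⟨i, c⟩
    by_cases h : (i : ℕ) < j + 1
    · simp [h]
    · have : i = Fin.last (j + 1) := by ext; simp; omega
      subst this; simp

theorem blockCol_succ_submatrix (x : MatSeq q) (j : ℕ) :
    (blockCol x (j + 1)).submatrix (lastBlockEquiv q j) id =
      Matrix.fromRows (blockCol x j) (x (j + 1)) := by
  ext (⟨i, c⟩ | c) d <;> simp [blockCol, lastBlockEquiv]

theorem orthoRow_submatrix (f : MatSeq q) (j : ℕ) :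
    (orthoRow f j).submatrix id (lastBlockEquiv q j) =
      Matrix.fromCols (-((blockCol (fun k => f (j + 1 + k)) j)ᴴ * (blockHankel f j)⁻¹)) 1 := by
  ext d (⟨i, c⟩ | c)
  · have hi : (i : ℕ) < j + 1 := i.2
    simp only [orthoRow, lastBlockEquiv, Matrix.submatrix_apply, Matrix.of_apply, Equiv.coe_fn_mk,
      Sum.elim_inl, Fin.val_castSucc, hi, dite_true, Matrix.fromCols_apply_inl, id]
  · simp [orthoRow, lastBlockEquiv]

theorem orthoRow_mul_blockCol (f x : MatSeq q) (j : ℕ) :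
    orthoRow f j * blockCol x (j + 1) =
      x (j + 1) - (blockCol (fun k => f (j + 1 + k)) j)ᴴ * (blockHankel f j)⁻¹ * blockCol x j := by
  have h := Matrix.submatrix_mul_equiv (orthoRow f j) (blockCol x (j + 1)) id (lastBlockEquiv q j) id
  rw [orthoRow_submatrix, blockCol_succ_submatrix, Matrix.submatrix_id_id,
    Matrix.fromCols_mul_fromRows] at h
  rw [← h, Matrix.one_mul, Matrix.neg_mul]
  abel

/-- Hermitian entries are what makes the last block row the adjoint of the last block column, the
shape `schur_increment` needs. -/
theorem blockHankel_succ_submatrix {f : MatSeq q} {j : ℕ}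
    (hf : ∀ k ≤ 2 * j + 1, (f k).IsHermitian) :
    (blockHankel f (j + 1)).submatrix (lastBlockEquiv q j) (lastBlockEquiv q j) =
      Matrix.fromBlocks (blockHankel f j) (blockCol (fun k => f (j + 1 + k)) j)
        (blockCol (fun k => f (j + 1 + k)) j)ᴴ (f (j + 1 + (j + 1))) := by
  ext (⟨i, c⟩ | c) (⟨k, d⟩ | d)
  · simp [blockHankel, lastBlockEquiv]
  · simp [blockHankel, blockCol, lastBlockEquiv, add_comm]
  · simp only [blockHankel, blockCol, lastBlockEquiv, Matrix.submatrix_apply, Matrix.of_apply,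
      Equiv.coe_fn_mk, Sum.elim_inl, Sum.elim_inr, Matrix.fromBlocks_apply₂₁,
      Matrix.conjTranspose_apply, Fin.val_last, Fin.val_castSucc]
    exact ((hf (j + 1 + k) (by omega)).apply c d).symm
  · simp [blockHankel, lastBlockEquiv]

theorem blockHankel_isHermitian {f : MatSeq q} {j : ℕ} (hf : ∀ k ≤ 2 * j, (f k).IsHermitian) :
    (blockHankel f j).IsHermitian := by
  ext ⟨i, c⟩ ⟨k, d⟩
  simp only [blockHankel, Matrix.conjTranspose_apply, Matrix.of_apply]
  rw [add_comm (k : ℕ) i]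
  exact (hf (i + k) (by omega)).apply _ _

theorem isHermitian_of_blockHankel {f : MatSeq q} {j : ℕ} (h : (blockHankel f j).IsHermitian)
    {k : ℕ} (hk : k ≤ 2 * j) : (f k).IsHermitian := by
  obtain ⟨l, r, hl, hr, rfl⟩ : ∃ l r, l ≤ j ∧ r ≤ j ∧ k = l + r :=
    ⟨min k j, k - min k j, by omega, by omega, by omega⟩
  ext c d
  have := h.apply (⟨l, by omega⟩, c) (⟨r, by omega⟩, d)
  simpa [blockHankel, add_comm] using this

theorem blockHankel_posDef_of_le {f : MatSeq q} {i j : ℕ} (hij : i ≤ j)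
    (h : (blockHankel f j).PosDef) : (blockHankel f i).PosDef := by
  have he : Function.Injective
      (Prod.map (Fin.castLE (by omega : i + 1 ≤ j + 1)) id : Fin (i + 1) × Fin q → _) :=
    (Fin.castLE_injective _).prodMap Function.injective_id
  exact h.submatrix he

theorem conjTranspose_blockCol_mul_inv_zero (f x : MatSeq q) :
    (blockCol x 0)ᴴ * (blockHankel f 0)⁻¹ * blockCol x 0 = (x 0)ᴴ * (f 0)⁻¹ * x 0 := by
  let e : Fin q ≃ Fin 1 × Fin q := (Equiv.uniqueProd (Fin q) (Fin 1)).symm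
  have hx : (blockCol x 0).submatrix e id = x 0 := by ext; simp [blockCol, e]
  have hH : (blockHankel f 0).submatrix e e = f 0 := by ext; simp [blockHankel, e]
  rw [← hH, ← hx, Matrix.inv_submatrix_equiv, Matrix.conjTranspose_submatrix,
    Matrix.submatrix_mul_equiv, Matrix.submatrix_mul_equiv, Matrix.submatrix_id_id]

/-! ### Orthogonal matrix polynomials and their norms -/

/-- The coefficients of the monic orthogonal matrix polynomial of degree `j`. -/
noncomputable def orthoCoeff (f : MatSeq q) : ℕ → MatSeq q
  | 0, _ => 1
  | j + 1, i => if h : i < j + 2 then Matrix.of fun c d => orthoRow f j c (⟨i, h⟩, d) else 0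

/-- The value of the monic orthogonal polynomial of degree `j` on the sequence `x`. -/
noncomputable def orthoEval (f : MatSeq q) (j : ℕ) (x : MatSeq q) : Matrix (Fin q) (Fin q) ℂ :=
  ∑ i ∈ Finset.range (j + 1), orthoCoeff f j i * x i

/-- The squared norm of the monic orthogonal polynomial of degree `j`. -/
noncomputable def orthoNorm (f : MatSeq q) (j : ℕ) : Matrix (Fin q) (Fin q) ℂ :=
  orthoEval f j fun i => f (i + j)

theorem orthoEval_zero (f x : MatSeq q) : orthoEval f 0 x = x 0 := by
  simp [orthoEval, orthoCoeff]

theorem orthoCoeff_self (f : MatSeq q) (j : ℕ) : orthoCoeff f j j = 1 := by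
  cases j with
  | zero => rfl
  | succ j => ext; simp [orthoCoeff, orthoRow]

theorem orthoEval_succ (f x : MatSeq q) (j : ℕ) :
    orthoEval f (j + 1) x = orthoRow f j * blockCol x (j + 1) := by
  ext c d
  rw [orthoEval, Finset.sum_range, Matrix.sum_apply, Matrix.mul_apply, Fintype.sum_prod_type]
  refine Finset.sum_congr rfl fun i _ => ?_
  simp [Matrix.mul_apply, orthoCoeff, blockCol]

/-- The squared norm is the Schur complement of the bordered Hankel matrix; this links it to
`schur_increment`. -/
theorem orthoNorm_succ (f : MatSeq q) (j : ℕ) :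
    orthoNorm f (j + 1) = f (j + 1 + (j + 1)) -
      (blockCol (fun k => f (j + 1 + k)) j)ᴴ * (blockHankel f j)⁻¹ *
        blockCol (fun k => f (j + 1 + k)) j := by
  rw [orthoNorm, orthoEval_succ, orthoRow_mul_blockCol]
  simp only [add_comm _ (j + 1)]

/-- Orthogonality to lower powers: the shifted column is a block column of the Hankel matrix, so the
inverse in `orthoRow` cancels. -/
theorem orthoEval_shift_eq_zero {f : MatSeq q} {j l : ℕ} (hl : l < j)
    (hf : ∀ k < 2 * j, (f k).IsHermitian) (hH : ∀ i < j, IsUnit (blockHankel f i)) :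
    orthoEval f j (fun i => f (i + l)) = 0 := by
  obtain _ | j := j
  · omega
  rw [orthoEval_succ, orthoRow_mul_blockCol]
  -- The block unit vector that selects the `l`-th block column.
  let δ : MatSeq q := fun k => if k = l then 1 else 0
  have h1 : blockCol (fun i => f (i + l)) j = blockHankel f j * blockCol δ j := by
    ext ⟨i, c⟩ d
    rw [Matrix.mul_apply, Fintype.sum_prod_type, Finset.sum_eq_single ⟨l, hl⟩]
    · simp [blockCol, blockHankel, δ, Matrix.one_apply]
    · intro k _ hk
      have : (k : ℕ) ≠ l := fun h => hk (Fin.ext h)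
      simp [blockCol, δ, this]
    · simp
  have h2 : (blockCol (fun k => f (j + 1 + k)) j)ᴴ * blockCol δ j = f (j + 1 + l) := by
    ext c d
    rw [Matrix.mul_apply, Fintype.sum_prod_type, Finset.sum_eq_single ⟨l, hl⟩]
    · simpa [blockCol, δ, Matrix.one_apply] using (hf (j + 1 + l) (by omega)).apply c d
    · intro k _ hk
      have : (k : ℕ) ≠ l := fun h => hk (Fin.ext h)
      simp [blockCol, δ, this]
    · simp
  rw [h1, Matrix.mul_assoc, Matrix.nonsing_inv_mul_cancel_left _ _
    ((Matrix.isUnit_iff_isUnit_det _).1 (hH j (by omega))), h2, sub_self]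

/-- The value `x_jᴴ F_j⁻¹ x_j` of the inverse Hankel form on the block column `x_0, …, x_j`. -/
noncomputable def invForm (f x : MatSeq q) (j : ℕ) : Matrix (Fin q) (Fin q) ℂ :=
  (blockCol x j)ᴴ * (blockHankel f j)⁻¹ * blockCol x j

theorem orthoNorm_isHermitian {f : MatSeq q} {j : ℕ} (hf : ∀ k ≤ 2 * j, (f k).IsHermitian) :
    (orthoNorm f j)ᴴ = orthoNorm f j := by
  obtain _ | j := j
  · simpa [orthoNorm, orthoEval_zero] using (hf 0 (by omega)).eq
  have hi : ((blockHankel f j)⁻¹)ᴴ = (blockHankel f j)⁻¹ :=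
    (blockHankel_isHermitian fun k hk => hf k (by omega)).inv
  rw [orthoNorm_succ, Matrix.conjTranspose_sub, (hf _ (by omega)).eq]
  simp [hi, Matrix.mul_assoc]

theorem invForm_increment {f : MatSeq q} {j : ℕ} (hf : ∀ k ≤ 2 * j + 1, (f k).IsHermitian)
    (h0 : IsUnit (blockHankel f j)) (h1 : IsUnit (blockHankel f (j + 1))) (x : MatSeq q) :
    IsUnit (orthoNorm f (j + 1)) ∧
    invForm f x (j + 1) - invForm f x j =
      (orthoEval f (j + 1) x)ᴴ * (orthoNorm f (j + 1))⁻¹ * orthoEval f (j + 1) x := by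
  have e := blockHankel_succ_submatrix hf
  have hu : IsUnit ((blockHankel f (j + 1)).submatrix (lastBlockEquiv q j) (lastBlockEquiv q j)) :=
    (Matrix.isUnit_submatrix_equiv _ _).2 h1
  rw [e] at hu
  have hs := schur_increment h0 (blockHankel_isHermitian fun k hk => hf k (by omega)) hu
    (blockCol x j) (x (j + 1))
  rw [← orthoNorm_succ, ← orthoRow_mul_blockCol, ← orthoEval_succ] at hs
  refine ⟨hs.1, ?_⟩
  rw [← hs.2, ← e, ← blockCol_succ_submatrix, Matrix.inv_submatrix_equiv,
    Matrix.conjTranspose_submatrix, Matrix.submatrix_mul_equiv, Matrix.submatrix_mul_equiv,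
    Matrix.submatrix_id_id]
  rfl

theorem isUnit_orthoNorm_zero {f : MatSeq q} (h : IsUnit (blockHankel f 0)) :
    IsUnit (orthoNorm f 0) := by
  let e : Fin q ≃ Fin 1 × Fin q := (Equiv.uniqueProd (Fin q) (Fin 1)).symm
  have hH : (blockHankel f 0).submatrix e e = f 0 := by ext; simp [blockHankel, e]
  simpa [orthoNorm, orthoEval_zero, ← hH] using (Matrix.isUnit_submatrix_equiv e e).2 h

theorem invForm_zero (f x : MatSeq q) :
    invForm f x 0 = (orthoEval f 0 x)ᴴ * (orthoNorm f 0)⁻¹ * orthoEval f 0 x := by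
  simp only [orthoNorm, orthoEval_zero, Nat.add_zero]
  exact conjTranspose_blockCol_mul_inv_zero f x

/-! ### Division by `x - a` and factorization of the norms -/

/-- Division of a matrix polynomial by `x - z`, evaluated on an arbitrary sequence. -/
theorem exists_divide_linear (z : ℂ) (m : ℕ) : ∀ c : MatSeq q, ∃ r : MatSeq q, r m = c (m + 1) ∧
    ∀ h : MatSeq q, ∑ i ∈ Finset.range (m + 2), c i * h i =
      (∑ i ∈ Finset.range (m + 2), c i * (z ^ i • 1)) * h 0 +
        ∑ i ∈ Finset.range (m + 1), r i * (h (i + 1) - z • h i) := by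
  induction m with
  | zero =>
    refine fun c => ⟨fun _ => c 1, rfl, fun h => ?_⟩
    simp [Finset.sum_range_succ, mul_sub, add_mul]
  | succ m ih =>
    intro c
    -- Horner step: modulo `x - z`, the leading `x ^ (m + 2)` is `z * x ^ (m + 1)`, so its
    -- coefficient is folded into the next one.
    obtain ⟨r, -, hr⟩ := ih (Function.update c (m + 1) (c (m + 1) + z • c (m + 2)))
    have key : ∀ h : MatSeq q, ∑ i ∈ Finset.range (m + 2),
        Function.update c (m + 1) (c (m + 1) + z • c (m + 2)) i * h i =
        ∑ i ∈ Finset.range (m + 2), c i * h i + z • (c (m + 2) * h (m + 1)) := by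
      intro h
      rw [Finset.sum_range_succ, Finset.sum_range_succ _ (m + 1), Function.update_self,
        Finset.sum_congr rfl fun i hi => by
          rw [Function.update_of_ne (by have := Finset.mem_range.1 hi; omega)]]
      simp [add_mul, add_assoc]
    refine ⟨fun i => if i = m + 1 then c (m + 2) else r i, by simp, fun h => ?_⟩
    have h1 := hr h
    rw [key, key fun i => z ^ i • 1] at h1
    have hsum : ∑ i ∈ Finset.range (m + 1 + 1),
        (if i = m + 1 then c (m + 2) else r i) * (h (i + 1) - z • h i) =
        ∑ i ∈ Finset.range (m + 1), r i * (h (i + 1) - z • h i) +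
          c (m + 2) * (h (m + 2) - z • h (m + 1)) := by
      rw [Finset.sum_range_succ, if_pos rfl, Finset.sum_congr rfl fun i hi => by
        rw [if_neg (by have := Finset.mem_range.1 hi; omega)]]
    rw [Finset.sum_range_succ, eq_sub_of_add_eq h1, Finset.sum_range_succ _ (m + 2), hsum]
    simp only [mul_sub, Matrix.mul_smul, mul_one, add_mul, smul_smul, pow_succ', Matrix.smul_mul]
    abel

theorem sLower_isHermitian {g : MatSeq q} {a : ℝ} {k : ℕ} (h0 : (g k).IsHermitian)
    (h1 : (g (k + 1)).IsHermitian) : (sLower g a k).IsHermitian := by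
  simp [Matrix.IsHermitian, sLower, h0.eq, h1.eq]

/-- The conjugate-linear pairing of the shifted sequence with the orthogonal polynomial. -/
theorem sum_mul_conjTranspose_orthoCoeff {f x : MatSeq q} {j : ℕ}
    (hx : ∀ k ≤ j, (x k).IsHermitian) :
    ∑ l ∈ Finset.range (j + 1), x l * (orthoCoeff f j l)ᴴ = (orthoEval f j x)ᴴ := by
  rw [orthoEval, Matrix.conjTranspose_sum]
  refine Finset.sum_congr rfl fun l hl => ?_
  rw [Matrix.conjTranspose_mul, (hx l (by have := Finset.mem_range.1 hl; omega)).eq]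

/-- The common computation: pair the degree `m + 1` polynomial of `g` with the degree `j`
polynomial of `sLower g a`. -/
theorem orthoEval_pairing {g : MatSeq q} {a : ℝ} {m j : ℕ}
    (hg : ∀ k ≤ m + j + 1, (g k).IsHermitian) :
    ∃ r : MatSeq q, r m = 1 ∧
    ∑ l ∈ Finset.range (j + 1), orthoEval g (m + 1) (fun i => g (i + l)) *
        (orthoCoeff (sLower g a) j l)ᴴ =
      orthoEval g (m + 1) (fun i => (a : ℂ) ^ i • 1) * (orthoEval (sLower g a) j g)ᴴ +
      ∑ i ∈ Finset.range (m + 1), r i *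
        (orthoEval (sLower g a) j fun l => sLower g a (l + i))ᴴ := by
  obtain ⟨r, hr, h⟩ := exists_divide_linear (a : ℂ) m (orthoCoeff g (m + 1))
  refine ⟨r, hr.trans (orthoCoeff_self _ _), ?_⟩
  -- For this sequence `h`, the difference `h (i + 1) - a • h i` is the same pairing with `sLower g
  -- a` in place of `g`.
  have := h fun i => ∑ l ∈ Finset.range (j + 1), g (i + l) * (orthoCoeff (sLower g a) j l)ᴴ
  rw [← sum_mul_conjTranspose_orthoCoeff fun k hk => hg k (by omega)]
  convert this using 1
  · simp only [orthoEval, Finset.sum_mul, Finset.mul_sum, Matrix.mul_assoc]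
    exact Finset.sum_comm
  · congr 1
    · simp [orthoEval]
    · refine Finset.sum_congr rfl fun i hi => ?_
      have hi := Finset.mem_range.1 hi
      rw [← sum_mul_conjTranspose_orthoCoeff fun k hk =>
        sLower_isHermitian (hg _ (by omega)) (hg _ (by omega)), Finset.smul_sum,
        ← Finset.sum_sub_distrib]
      refine congrArg _ (Finset.sum_congr rfl fun l _ => ?_)
      rw [sLower, ← Matrix.smul_mul, ← Matrix.sub_mul, add_comm l i, add_right_comm]
      congr 1
      abel

/-- Pair degree `j + 1` with degree `j`: the left side vanishes, and of the monic degree `j`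
quotient only the top term survives. -/
theorem orthoNorm_sLower_eq {g : MatSeq q} {a : ℝ} {j : ℕ}
    (hg : ∀ k ≤ 2 * j + 1, (g k).IsHermitian) (hH : ∀ i ≤ j, IsUnit (blockHankel g i))
    (hK : ∀ i < j, IsUnit (blockHankel (sLower g a) i)) :
    orthoNorm (sLower g a) j =
      -(orthoEval g (j + 1) (fun i => (a : ℂ) ^ i • 1) * (orthoEval (sLower g a) j g)ᴴ) := by
  have hf : ∀ k ≤ 2 * j, (sLower g a k).IsHermitian := fun k hk =>
    sLower_isHermitian (hg _ (by omega)) (hg _ (by omega))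
  obtain ⟨r, hr, h⟩ := orthoEval_pairing (g := g) (a := a) (m := j) (j := j)
    fun k hk => hg k (by omega)
  rw [Finset.sum_eq_zero, Finset.sum_range_succ, Finset.sum_eq_zero, zero_add, hr, one_mul,
    ← orthoNorm, orthoNorm_isHermitian hf] at h
  · exact (neg_eq_of_add_eq_zero_right h.symm).symm
  · intro i hi
    rw [orthoEval_shift_eq_zero (Finset.mem_range.1 hi) (fun k hk => hf k hk.le) hK]
    simp
  · intro l hl
    rw [orthoEval_shift_eq_zero (Finset.mem_range.1 hl) (fun k hk => hg k (by omega))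
      (fun i hi => hH i (by omega)), zero_mul]

/-- Pair equal degrees: the quotient has degree below `j` and drops out, while the left side keeps
only its top term. -/
theorem orthoNorm_eq {g : MatSeq q} {a : ℝ} {j : ℕ}
    (hg : ∀ k ≤ 2 * j, (g k).IsHermitian) (hH : ∀ i < j, IsUnit (blockHankel g i))
    (hK : ∀ i < j, IsUnit (blockHankel (sLower g a) i)) :
    orthoNorm g j =
      orthoEval g j (fun i => (a : ℂ) ^ i • 1) * (orthoEval (sLower g a) j g)ᴴ := by
  obtain _ | j := j
  · simpa [orthoNorm, orthoEval_zero] using (hg 0 (by omega)).eq.symm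
  have hf : ∀ k ≤ 2 * j + 1, (sLower g a k).IsHermitian := fun k hk =>
    sLower_isHermitian (hg _ (by omega)) (hg _ (by omega))
  obtain ⟨r, -, h⟩ := orthoEval_pairing (g := g) (a := a) (m := j) (j := j + 1)
    fun k hk => hg k (by omega)
  rw [Finset.sum_range_succ, Finset.sum_eq_zero, zero_add, orthoCoeff_self, ← orthoNorm,
    Finset.sum_eq_zero, add_zero, Matrix.conjTranspose_one, mul_one] at h
  · exact h
  · intro i hi
    rw [orthoEval_shift_eq_zero (Finset.mem_range.1 hi) (fun k hk => hf k (by omega)) hK]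
    simp
  · intro l hl
    rw [orthoEval_shift_eq_zero (Finset.mem_range.1 hl) (fun k hk => hg k (by omega)) hH, zero_mul]

/-- Hermitian symmetry gives `S = A * Bᴴ = B * Aᴴ`, so either factor cancels against `S⁻¹`. -/
theorem form_eq_of_factorization {S A B : Matrix (Fin q) (Fin q) ℂ} (hS : IsUnit S)
    (hSh : Sᴴ = S) (h : S = A * Bᴴ) :
    IsUnit A ∧ IsUnit B ∧ Aᴴ * S⁻¹ * A = B⁻¹ * A ∧ Bᴴ * S⁻¹ * B = A⁻¹ * B := by
  have hB : S = B * Aᴴ := by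
    rw [← hSh, h, Matrix.conjTranspose_mul, Matrix.conjTranspose_conjTranspose]
  have hu : ∀ {X Y : Matrix (Fin q) (Fin q) ℂ}, S = X * Yᴴ →
      IsUnit X ∧ Yᴴ * S⁻¹ * Y = X⁻¹ * Y := by
    intro X Y hXY
    have hd := (Matrix.isUnit_iff_isUnit_det _).1 hS
    rw [hXY, Matrix.det_mul] at hd
    have hX := isUnit_of_mul_isUnit_left hd
    refine ⟨(Matrix.isUnit_iff_isUnit_det _).2 hX, ?_⟩
    rw [hXY, Matrix.mul_inv_rev, ← Matrix.mul_assoc,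
      Matrix.mul_nonsing_inv _ (isUnit_of_mul_isUnit_right hd), Matrix.one_mul]
  exact ⟨(hu h).1, (hu hB).1, (hu hB).2, (hu h).2⟩

/-- The increments of the inverse forms. -/
noncomputable def invFormStep (f x : MatSeq q) : ℕ → Matrix (Fin q) (Fin q) ℂ
  | 0 => invForm f x 0
  | j + 1 => invForm f x (j + 1) - invForm f x j

theorem invFormStep_eq {f : MatSeq q} {j : ℕ} (hf : ∀ k ≤ 2 * j, (f k).IsHermitian)
    (hH : ∀ i ≤ j, IsUnit (blockHankel f i)) (x : MatSeq q) :
    IsUnit (orthoNorm f j) ∧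
    invFormStep f x j = (orthoEval f j x)ᴴ * (orthoNorm f j)⁻¹ * orthoEval f j x := by
  cases j with
  | zero => exact ⟨isUnit_orthoNorm_zero (hH 0 le_rfl), invForm_zero f x⟩
  | succ j =>
    exact invForm_increment (fun k hk => hf k (by omega)) (hH _ (by omega)) (hH _ le_rfl) x

/-- The Stieltjes parameters of a Hermitian sequence `g` and of `sLower g a`. -/
theorem stieltjes_parameters {g : MatSeq q} {a : ℝ} {j : ℕ}
    (hg : ∀ k ≤ 2 * j + 1, (g k).IsHermitian) (hH : ∀ i ≤ j, IsUnit (blockHankel g i))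
    (hK : ∀ i ≤ j, IsUnit (blockHankel (sLower g a) i)) :
    IsUnit (orthoEval (sLower g a) j g) ∧
    invFormStep g (fun i => (a : ℂ) ^ i • 1) j =
      (orthoEval (sLower g a) j g)⁻¹ * orthoEval g j (fun i => (a : ℂ) ^ i • 1) ∧
    IsUnit (orthoEval g (j + 1) (fun i => (a : ℂ) ^ i • 1)) ∧
    invFormStep (sLower g a) g j =
      -((orthoEval g (j + 1) (fun i => (a : ℂ) ^ i • 1))⁻¹ * orthoEval (sLower g a) j g) := by
  have hf : ∀ k ≤ 2 * j, (sLower g a k).IsHermitian := fun k hk =>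
    sLower_isHermitian (hg _ (by omega)) (hg _ (by omega))
  obtain ⟨uM, eM⟩ := invFormStep_eq (fun k hk => hg k (by omega)) hH (fun i => (a : ℂ) ^ i • 1)
  obtain ⟨uL, eL⟩ := invFormStep_eq hf hK g
  obtain ⟨-, h1, h2, -⟩ := form_eq_of_factorization uM
    (orthoNorm_isHermitian fun k hk => hg k (by omega))
    (orthoNorm_eq (fun k hk => hg k (by omega)) (fun i hi => hH i hi.le) fun i hi => hK i hi.le)
  obtain ⟨h3, -, -, h4⟩ := form_eq_of_factorization
    (A := -orthoEval g (j + 1) (fun i => (a : ℂ) ^ i • 1)) uL (orthoNorm_isHermitian hf)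
    ((orthoNorm_sLower_eq hg hH fun i hi => hK i hi.le).trans (Matrix.neg_mul _ _).symm)
  have h3' := (IsUnit.neg_iff _).1 h3
  refine ⟨h1, eM.trans h2, h3', eL.trans (h4.trans ?_)⟩
  rw [inv_neg_matrix _ h3', Matrix.neg_mul]

end Blocks

/-! ### Action of the resolvent on block columns -/

section Resolvent

variable {q : ℕ}

theorem T_mul_blockCol (x : MatSeq q) (j : ℕ) :
    T q j * blockCol x j = blockCol (fun k => Nat.casesOn k 0 x) j := by
  ext ⟨⟨i, hi⟩, c⟩ d
  rw [Matrix.mul_apply, Fintype.sum_prod_type]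
  cases i with
  | zero => simp [T, blockCol]
  | succ i =>
    rw [Finset.sum_eq_single ⟨i, by omega⟩]
    · simp [T, blockCol]
    · intro k _ hk
      have : i ≠ k := fun h => hk (Fin.ext h.symm)
      simp [T, this]
    · simp

theorem T_pow_apply (j k : ℕ) (p r : Fin (j + 1) × Fin q) (h : (p.1 : ℕ) < k) :
    (T q j ^ k) p r = 0 := by
  induction k generalizing p with
  | zero => omega
  | succ k ih =>
    rw [pow_succ', Matrix.mul_apply]
    refine Finset.sum_eq_zero fun t _ => ?_
    by_cases ht : (p.1 : ℕ) = t.1 + 1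
    · rw [ih t (by omega), mul_zero]
    · simp [T, ht]

theorem isUnit_one_sub_smul_T (j : ℕ) (z : ℂ) : IsUnit (1 - z • T q j) := by
  have : T q j ^ (j + 1) = 0 := by
    ext p r
    exact T_pow_apply j _ p r p.1.2
  exact (IsNilpotent.smul ⟨_, this⟩ z).isUnit_one_sub

/-- The recursion says `y = (1 - z • T) x`, so the resolvent is never expanded as a series. -/
theorem R_mul_blockCol {x y : MatSeq q} {z : ℂ} (h0 : y 0 = x 0)
    (h : ∀ k, y (k + 1) = x (k + 1) - z • x k) (j : ℕ) :
    R q j z * blockCol y j = blockCol x j := by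
  have : blockCol y j = (1 - z • T q j) * blockCol x j := by
    rw [Matrix.sub_mul, Matrix.one_mul, Matrix.smul_mul, T_mul_blockCol]
    ext ⟨⟨i, hi⟩, c⟩ d
    cases i <;> simp [blockCol, h0, h]
  rw [this, R, Matrix.nonsing_inv_mul_cancel_left _ _
    ((Matrix.isUnit_iff_isUnit_det _).1 (isUnit_one_sub_smul_T j z))]

theorem R_mul_v (j : ℕ) (z : ℂ) : R q j z * v q j = blockCol (fun i => z ^ i • 1) j :=
  R_mul_blockCol (by simp) (fun k => by simp [pow_succ', smul_smul]) j

theorem blockCol_neg (x : MatSeq q) (j : ℕ) : blockCol (fun i => -x i) j = -blockCol x j := rfl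

theorem R_mul_uTilde2 (g : MatSeq q) (a : ℝ) (j : ℕ) :
    R q j a * uTilde2 g a j = -blockCol g j := by
  rw [← blockCol_neg]
  refine R_mul_blockCol (y := fun k => match k with
    | 0 => -g 0
    | l + 1 => -g (l + 1) + (a : ℂ) • g l) rfl (fun k => ?_) j
  rw [smul_neg, sub_neg_eq_add]

theorem sLower_sUpper (s : MatSeq q) (a b : ℝ) : sLower (sUpper s b) a = sHat s a b := by
  funext k
  simp only [sLower, sUpper, sHat, smul_sub, smul_smul, Complex.ofReal_mul, Complex.ofReal_add,
    add_smul]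
  abel

/-- Reduces the data of the new parameters to those of the old ones for `sUpper s b`. -/
theorem u2_add (s : MatSeq q) (a b : ℝ) (j : ℕ) :
    u2 s a b j + (a : ℂ) • (v q j * s 0) = uTilde2 (sUpper s b) a j := by
  ext ⟨⟨i, hi⟩, c⟩ d
  have hv : ((v q j) * s 0) (⟨i, hi⟩, c) d = if i = 0 then s 0 c d else 0 := by
    cases i <;> simp [v, blockCol, Matrix.mul_apply, Matrix.one_apply]
  rw [Matrix.add_apply, Matrix.smul_apply, hv]
  cases i with
  | zero =>
    simp [u2, uTilde2, blockCol, u20, sUpper]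
    ring
  | succ i =>
    simp [u2, uTilde2, blockCol, ← sLower_sUpper, sLower]

end Resolvent

/-! ### Translation into orthogonal polynomials and inverse forms -/

section Identification

variable {q : ℕ}

theorem P1_eq (s : MatSeq q) (j : ℕ) (z : ℂ) :
    P1 s j z = orthoEval s j (fun i => z ^ i • 1) := by
  cases j with
  | zero => simp [P1, orthoEval_zero]
  | succ j => rw [P1, Matrix.mul_assoc, R_mul_v, orthoEval_succ]

theorem Gamma1_eq_P1 (s : MatSeq q) (b : ℝ) (j : ℕ) (z : ℂ) :
    Gamma1 s b j z = P1 (sUpper s b) j z := by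
  cases j <;> rfl

theorem Theta2_eq (s : MatSeq q) (a : ℝ) (j : ℕ) :
    Theta2 s a j a = -orthoEval (sLower s a) j s := by
  cases j with
  | zero => simp [Theta2, orthoEval_zero]
  | succ j => rw [Theta2, Matrix.mul_assoc, R_mul_uTilde2, orthoEval_succ, Matrix.mul_neg]

theorem Q2_eq (s : MatSeq q) (a b : ℝ) (j : ℕ) :
    Q2 s a b j a = orthoEval (sHat s a b) j (sUpper s b) := by
  cases j with
  | zero =>
    simp only [Q2, orthoEval_zero, u20, sUpper, Complex.ofReal_add, add_smul]
    abel
  | succ j =>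
    rw [Q2, Matrix.mul_assoc, u2_add, R_mul_uTilde2, orthoEval_succ, Matrix.mul_neg, neg_neg]

theorem mSumOld_eq (s : MatSeq q) (a : ℝ) (j : ℕ) :
    mSumOld s a j = invForm s (fun i => (a : ℂ) ^ i • 1) j := by
  rw [mSumOld, invForm, ← R_mul_v, Matrix.conjTranspose_mul, H1]
  simp only [Matrix.mul_assoc]

theorem lSumOld_eq (s : MatSeq q) (a : ℝ) (j : ℕ) :
    lSumOld s a j = invForm (sLower s a) s j := by
  have h : blockCol s j = -(R q j a * uTilde2 s a j) := by rw [R_mul_uTilde2, neg_neg]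
  rw [lSumOld, invForm, h, Matrix.conjTranspose_neg, Matrix.conjTranspose_mul, K2]
  simp only [Matrix.mul_assoc, Matrix.neg_mul, Matrix.mul_neg, neg_neg]

theorem mNew_eq (s : MatSeq q) (a b : ℝ) (j : ℕ) :
    mNew s a b j = invFormStep (sUpper s b) (fun i => (a : ℂ) ^ i • 1) j := by
  have h : ∀ i, tNew s a b i = mSumOld (sUpper s b) a i := fun _ => rfl
  cases j <;> simp only [mNew, invFormStep, h, mSumOld_eq]

theorem uTilde2_zero_form (g : MatSeq q) (a : ℝ) :
    (uTilde2 g a 0)ᴴ * (K2 g a 0)⁻¹ * uTilde2 g a 0 = invForm (sLower g a) g 0 := by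
  have h : uTilde2 g a 0 = -blockCol g 0 := by
    ext ⟨i, c⟩ d
    fin_cases i
    simp [uTilde2, blockCol]
  rw [h, invForm, Matrix.conjTranspose_neg, K2]
  simp

theorem lOld_eq (s : MatSeq q) (a : ℝ) (j : ℕ) :
    lOld s a j = invFormStep (sLower s a) s j := by
  cases j with
  | zero => exact uTilde2_zero_form s a
  | succ j => simp only [lOld, invFormStep, lSumOld_eq]

/-- The left factor contains `s 0` rather than its adjoint, hence the Hermitian hypothesis. -/
theorem lNew_eq {s : MatSeq q} (hs : (s 0).IsHermitian) (a b : ℝ) (j : ℕ) :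
    lNew s a b j = invFormStep (sHat s a b) (sUpper s b) j := by
  have hc : ∀ i, (u2 s a b i)ᴴ + (a : ℂ) • (s 0 * (v q i)ᴴ) = (uTilde2 (sUpper s b) a i)ᴴ := by
    intro i
    rw [← u2_add, Matrix.conjTranspose_add, Matrix.conjTranspose_smul, Matrix.conjTranspose_mul,
      hs.eq]
    simp
  have hK : ∀ i, H2 s a b i = K2 (sUpper s b) a i := fun i => by rw [K2, sLower_sUpper]; rfl
  have h : ∀ i, lSum s a b i = lSumOld (sUpper s b) a i := by
    intro i
    rw [lSum, hc, u2_add, hK]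
    rfl
  cases j with
  | zero =>
    rw [lNew, hc, u2_add, hK, uTilde2_zero_form, sLower_sUpper]
    rfl
  | succ j => simp only [lNew, invFormStep, h, lSumOld_eq, sLower_sUpper]

end Identification

/-! ### Positivity of the remaining Hankel matrices -/

section Positivity

variable {q : ℕ}

theorem blockHankel_smul_add (c : ℂ) (f g h : MatSeq q) (j : ℕ) (e : ∀ k, f k = c • (g k + h k)) :
    blockHankel f j = c • (blockHankel g j + blockHankel h j) := by
  ext p r
  simp [blockHankel, e]

/-- Uses `b - a = (b - x) + (x - a)`. -/
theorem H1_posDef_of_odd {s : MatSeq q} {a b : ℝ} (hab : a < b) {n : ℕ}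
    (h : HausdorffPosDefOdd s a b n) : (blockHankel s n).PosDef := by
  have hb : ((b : ℂ) - a) ≠ 0 := by exact_mod_cast (sub_pos.2 hab).ne'
  rw [blockHankel_smul_add (((b - a)⁻¹ : ℝ) : ℂ) s (sUpper s b) (sLower s a)]
  · refine (h.1.add h.2).smul ?_
    exact_mod_cast inv_pos.2 (sub_pos.2 hab)
  · intro k
    have : sUpper s b k + sLower s a k = ((b : ℂ) - a) • s k := by
      simp only [sUpper, sLower, sub_smul]; abel
    rw [this, smul_smul]
    push_cast
    rw [inv_mul_cancel₀ hb, one_smul]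

/-- The block Hankel matrix of `(b - x)² s` is positive semidefinite. -/
theorem blockHankel_sUpper_sUpper_posSemidef {s : MatSeq q} (b : ℝ) {n : ℕ}
    (h : (blockHankel s (n + 1)).PosSemidef) :
    (blockHankel (sUpper (sUpper s b) b) n).PosSemidef := by
  -- The matrix of multiplication by `b - x` on coefficient vectors; congruence by it multiplies the
  -- weight by `(b - x)²`.
  let B : Matrix (Fin (n + 2) × Fin q) (Fin (n + 1) × Fin q) ℂ := Matrix.of fun p r =>
    if p.2 = r.2 then (if p.1 = r.1.castSucc then (b : ℂ) else 0) -
      (if p.1 = r.1.succ then 1 else 0) else 0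
  convert h.conjTranspose_mul_mul_same B using 1
  have hB : ∀ (w : Fin (n + 2) × Fin q → ℂ) (i : Fin (n + 1)) (c : Fin q),
      ∑ p, w p * B p (i, c) = b * w (i.castSucc, c) - w (i.succ, c) := by
    intro w i c
    rw [Fintype.sum_prod_type]
    simp [B, sub_mul, mul_comm (w _), Finset.sum_sub_distrib]
  have hB' : ∀ (w : Fin (n + 2) × Fin q → ℂ) (i : Fin (n + 1)) (c : Fin q),
      ∑ p, Bᴴ (i, c) p * w p = b * w (i.castSucc, c) - w (i.succ, c) := by
    intro w i c
    rw [← hB]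
    refine Finset.sum_congr rfl fun p _ => ?_
    rw [mul_comm, Matrix.conjTranspose_apply]
    congr 1
    simp only [B, Matrix.of_apply]
    split_ifs <;> simp
  ext ⟨i, c⟩ ⟨k, d⟩
  rw [Matrix.mul_apply, hB, Matrix.mul_apply, Matrix.mul_apply, hB', hB']
  simp only [blockHankel, sUpper, Matrix.of_apply, Matrix.sub_apply, Matrix.smul_apply,
    smul_eq_mul, Fin.val_castSucc, Fin.val_succ]
  rw [show (i : ℕ) + 1 + k = i + k + 1 by omega, show (i : ℕ) + (k + 1) = i + k + 1 by omega,
    show (i : ℕ) + 1 + (k + 1) = i + k + 1 + 1 by omega]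

/-- Uses `(b - a)(b - x) = (b - x)(x - a) + (b - x)²`. -/
theorem K1_posDef_of_even {s : MatSeq q} {a b : ℝ} (hab : a < b) {n : ℕ}
    (h : HausdorffPosDefEven s a b (n + 1)) : (blockHankel (sUpper s b) n).PosDef := by
  have hb : ((b : ℂ) - a) ≠ 0 := by exact_mod_cast (sub_pos.2 hab).ne'
  rw [blockHankel_smul_add (((b - a)⁻¹ : ℝ) : ℂ) _ (sHat s a b) (sUpper (sUpper s b) b)]
  · refine ((h.2 n rfl).add_posSemidef (blockHankel_sUpper_sUpper_posSemidef b
      h.1.posSemidef)).smul ?_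
    exact_mod_cast inv_pos.2 (sub_pos.2 hab)
  · intro k
    have : sHat s a b k + sUpper (sUpper s b) b k = ((b : ℂ) - a) • sUpper s b k := by
      rw [← sLower_sUpper, sUpper, sLower, sub_smul]; abel
    rw [this, smul_smul]
    push_cast
    rw [inv_mul_cancel₀ hb, one_smul]

/-- Positive definiteness of both Hankel matrices gives the parameters of all lower orders. -/
theorem stieltjes_parameters_of_posDef {g : MatSeq q} {a : ℝ} {n : ℕ}
    (hg : (blockHankel g n).PosDef) (hf : (blockHankel (sLower g a) n).PosDef) {j : ℕ}
    (hj : j ≤ n) :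
    IsUnit (orthoEval (sLower g a) j g) ∧
    invFormStep g (fun i => (a : ℂ) ^ i • 1) j =
      (orthoEval (sLower g a) j g)⁻¹ * orthoEval g j (fun i => (a : ℂ) ^ i • 1) ∧
    IsUnit (orthoEval g (j + 1) (fun i => (a : ℂ) ^ i • 1)) ∧
    invFormStep (sLower g a) g j =
      -((orthoEval g (j + 1) (fun i => (a : ℂ) ^ i • 1))⁻¹ * orthoEval (sLower g a) j g) := by
  have hgh : ∀ k ≤ 2 * n, (g k).IsHermitian := fun k =>
    isHermitian_of_blockHankel hg.isHermitian
  refine stieltjes_parameters (fun k hk => ?_)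
    (fun i hi => (blockHankel_posDef_of_le (hi.trans hj) hg).isUnit)
    (fun i hi => (blockHankel_posDef_of_le (hi.trans hj) hf).isUnit)
  -- The entry `g (2 * n + 1)` lies outside `blockHankel g n` and is recovered from the last entry
  -- of `sLower g a`.
  obtain hk | rfl : k ≤ 2 * n ∨ k = 2 * n + 1 := by omega
  · exact hgh k hk
  · have h1 := isHermitian_of_blockHankel hf.isHermitian le_rfl
    have h2 : g (2 * n + 1) = sLower g a (2 * n) + (a : ℂ) • g (2 * n) := by
      rw [sLower]; abel
    rw [h2, Matrix.IsHermitian, Matrix.conjTranspose_add, Matrix.conjTranspose_smul, h1.eq,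
      (hgh _ le_rfl).eq]
    simp

end Positivity

end HausdorffMoment

/-! ### The two families of parameters -/

theorem proposition7p6 (q : ℕ) (n : ℕ) (a b : ℝ) (hab : a < b)
    (s : ℕ → Matrix (Fin q) (Fin q) ℂ) :
    (1 ≤ n → HausdorffPosDefEven s a b n →
      mNew s a b 0 = (Q2 s a b 0 a)⁻¹ ∧
      (∀ j, j ≤ n - 1 → IsUnit (Q2 s a b j a) ∧
        mNew s a b j = (Q2 s a b j a)⁻¹ * Gamma1 s b j a) ∧
      (∀ j, j ≤ n - 1 → IsUnit (Gamma1 s b (j + 1) a) ∧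
        lNew s a b j = -((Gamma1 s b (j + 1) a)⁻¹ * Q2 s a b j a))) ∧
    (HausdorffPosDefOdd s a b n →
      mOld s a 0 = -(Theta2 s a 0 a)⁻¹ ∧
      IsUnit (Theta2 s a 0 a) ∧
      (∀ j, 1 ≤ j → j ≤ n → IsUnit (Theta2 s a j a) ∧
        mOld s a j = -((Theta2 s a j a)⁻¹ * P1 s j a)) ∧
      (∀ j, j ≤ n → IsUnit (P1 s (j + 1) a) ∧
        lOld s a j = (P1 s (j + 1) a)⁻¹ * Theta2 s a j a)) := by
  constructor
  · intro hn h
    obtain ⟨n, rfl⟩ : ∃ m, n = m + 1 := ⟨n - 1, by omega⟩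
    have hs : (s 0).IsHermitian := isHermitian_of_blockHankel h.1.isHermitian (Nat.zero_le _)
    have hf : (blockHankel (sLower (sUpper s b) a) n).PosDef := by
      rw [sLower_sUpper]; exact h.2 n rfl
    have key := fun j (hj : j ≤ n) =>
      stieltjes_parameters_of_posDef (K1_posDef_of_even hab h) hf hj
    simp only [sLower_sUpper, ← Q2_eq, ← P1_eq, ← Gamma1_eq_P1, ← mNew_eq, ← lNew_eq hs] at key
    refine ⟨?_, fun j hj => ⟨(key j hj).1, (key j hj).2.1⟩, fun j hj => (key j hj).2.2⟩
    rw [(key 0 (Nat.zero_le _)).2.1, Gamma1, Matrix.mul_one]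
  · intro h
    have key := fun j (hj : j ≤ n) =>
      stieltjes_parameters_of_posDef (H1_posDef_of_odd hab h) h.2 hj
    have hT : ∀ j, orthoEval (sLower s a) j s = -Theta2 s a j a := fun j => by
      rw [Theta2_eq, neg_neg]
    simp only [hT, ← P1_eq, ← lOld_eq, IsUnit.neg_iff] at key
    have h0 := (key 0 (Nat.zero_le _)).1
    refine ⟨?_, h0, fun j h1 hj => ⟨(key j hj).1, ?_⟩, fun j hj => ⟨(key j hj).2.2.1, ?_⟩⟩
    · rw [← inv_neg_matrix _ h0, Theta2, neg_neg, mOld]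
    · have e := (key j hj).2.1
      obtain ⟨j, rfl⟩ : ∃ m, j = m + 1 := ⟨j - 1, by omega⟩
      rw [invFormStep, ← mSumOld_eq, ← mSumOld_eq, inv_neg_matrix _ (key _ hj).1,
        Matrix.neg_mul] at e
      exact e
    · rw [(key j hj).2.2.2, Matrix.mul_neg, neg_neg]
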